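/- For $n\in\mathbb{N}$ let $K_n$ be the complete graph on the vertex set $[n]=\{1,\dots,n\}$, with edge set $E(K_n)$ the set of all 2-element subsets of $[n]$. The metric polytope $\mathcal{M}_n\subseteq[0,1]^{E(K_n)}$ is the set of all $d\in[0,1]^{E(K_n)}$ that satisfy the triangle inequality $d(\{i,k\})\le d(\{i,j\})+d(\{j,k\})$ for all distinct $i,j,k\in[n]$. Then, as $n\to\infty$, the $\binom n2$-dimensional Lebesgue volume of $\mathcal{M}_n$ satisfies $$\mathrm{vol}(\mathcal{M}_n)=\left(\tfrac12\right)^{\binom n2+o(n^2)}.$$ That is, there is a function $r:\mathbb{N}\to\mathbb{R}$ with $r(n)/n^2\to0$ as $n\to\infty$ such that $\mathrm{vol}(\mathcal{M}_n)=(1/2)^{\binom n2+r(n)}$ for every $n$. -/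

import Mathlib

open MeasureTheory Asymptotics

/-- The edge set `E(K_n)` of the complete graph on `n` vertices. -/
abbrev CompleteEdge (n : ℕ) : Type := (⊤ : SimpleGraph (Fin n)).edgeSet

/-- The edge of `K_n` joining two distinct vertices `i` and `j`. -/
def completeEdge {n : ℕ} (i j : Fin n) (h : i ≠ j) : CompleteEdge n :=
  ⟨s(i, j), (SimpleGraph.mem_edgeSet _).2 ((SimpleGraph.top_adj i j).2 h)⟩

/-- The metric polytope `M_n`: the set of all weightings `d` of the edges of `K_n` with values in
`[0, 1]` that satisfy the triangle inequality `d(ik) ≤ d(ij) + d(jk)` for all triples of distinct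
vertices `i, j, k`. -/
def metricPolytope (n : ℕ) : Set (CompleteEdge n → ℝ) :=
  {d | (∀ e, d e ∈ Set.Icc (0 : ℝ) 1) ∧
    ∀ (i j k : Fin n) (hij : i ≠ j) (hjk : j ≠ k) (hik : i ≠ k),
      d (completeEdge i k hik) ≤ d (completeEdge i j hij) + d (completeEdge j k hjk)}

/-!
The cube `[1/2, 1] ^ E(K_n)` lies in the metric polytope, which gives the lower bound. For the
upper bound, round distances to a grid of `N + 1` colours, so that a metric becomes a colouring of
the edges in which every triangle satisfies the triangle inequality up to one grid step. The weak
regularity lemma of Frieze and Kannan partitions the vertices into boundedly many classes; give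
each pair of classes the palette of colours that are not rare between them. Few edges lie outside
their palette, and by the counting lemma almost no triple of palettes contains a colour triple that
violates the rounded triangle inequality. A triple of palettes without violations has total size
at most `3 (N + 1) / 2 + 3`, so on average a palette has little more than half of the colours.

Hence `exp (o(n ^ 2))` choices of a partition and palettes suffice to cover the polytope by sets of
points obeying all but a small proportion of their palettes. By Chernoff's bound and
`x ≤ exp (2 * x - 1) / 2`, each such set has volume at most `(1 / 2) ^ (n.choose 2)` times
`exp (δ * n ^ 2)`.
-/

section

open Finset Function
open scoped BigOperators

section FiberMean

variable {α β γ : Type*} [Fintype α] [DecidableEq β] [DecidableEq γ]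

/-- The conditional expectation of `f`, for the uniform measure on `α`, given `ψ`: the average of
`f` over the fibre of `ψ` through `a`. -/
noncomputable def fiberMean (ψ : α → β) (f : α → ℝ) (a : α) : ℝ := 𝔼 b with ψ b = ψ a, f b

theorem factorsThrough_fiberMean (ψ : α → β) (f : α → ℝ) : (fiberMean ψ f).FactorsThrough ψ :=
  fun a b h ↦ by simp only [fiberMean, h]

theorem filter_fiber_nonempty (ψ : α → β) (a : α) : ({b | ψ b = ψ a} : Finset α).Nonempty :=
  ⟨a, by simp⟩

theorem fiberMean_mem_Icc (ψ : α → β) {f : α → ℝ} (hf : ∀ a, f a ∈ Set.Icc 0 1) (a : α) :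
    fiberMean ψ f a ∈ Set.Icc 0 1 :=
  ⟨expect_nonneg fun b _ ↦ (hf b).1, expect_le (filter_fiber_nonempty ψ a) fun b _ ↦ (hf b).2⟩

theorem fiberMean_one (ψ : α → β) : fiberMean ψ 1 = 1 :=
  funext fun a ↦ expect_const (filter_fiber_nonempty ψ a) 1

theorem sum_fiberMean {C : Type*} [Fintype C] (ψ : α → β) (f : C → α → ℝ) :
    ∑ c, fiberMean ψ (f c) = fiberMean ψ (∑ c, f c) := by
  ext a
  simp only [fiberMean, Finset.sum_apply, expect_sum_comm]

theorem fiberMean_id (f : α → ℝ) [DecidableEq α] : fiberMean id f = f := by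
  ext a
  simp [fiberMean, filter_eq']

theorem fiberMean_comp_equiv {ψ : α → β} {f : α → ℝ} {e : α ≃ α}
    (hψ : ∀ a b, ψ (e a) = ψ (e b) ↔ ψ a = ψ b) (a : α) :
    fiberMean ψ f (e a) = fiberMean ψ (f ∘ e) a :=
  (expect_equiv e (by simp [hψ]) fun _ _ ↦ rfl).symm

theorem fiberMean_comp_injective {ψ : α → β} {g : β → γ} (hg : g.Injective) (f : α → ℝ) :
    fiberMean (g ∘ ψ) f = fiberMean ψ f := by
  ext a
  simp only [fiberMean, Function.comp_apply, hg.eq_iff]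

theorem expect_fiberMean_mul {ψ : α → β} (f : α → ℝ) {g : α → ℝ} (hg : g.FactorsThrough ψ) :
    𝔼 a, fiberMean ψ f a * g a = 𝔼 a, f a * g a := by
  simp only [Fintype.expect_eq_sum_div_card]
  congr 1
  calc ∑ a, fiberMean ψ f a * g a
      = ∑ a, ∑ b, if ψ b = ψ a then f b * g b / #{x | ψ x = ψ b} else 0 := by
        refine sum_congr rfl fun a _ ↦ ?_
        rw [fiberMean, expect_eq_sum_div_card, ← sum_filter, div_mul_eq_mul_div, sum_mul, sum_div]
        refine sum_congr rfl fun b hb ↦ ?_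
        have hba : ψ b = ψ a := (mem_filter.1 hb).2
        rw [hg hba, hba]
    _ = ∑ b, ∑ a with ψ a = ψ b, f b * g b / #{x | ψ x = ψ b} := by
        rw [sum_comm]
        simp only [sum_filter, eq_comm]
    _ = ∑ b, f b * g b := by
        refine sum_congr rfl fun b _ ↦ ?_
        have := (filter_fiber_nonempty ψ b).card_ne_zero
        rw [sum_const, nsmul_eq_mul]
        field_simp

/-- The energy of the partition into fibres of `ψ`: the mean square of the fibre means of `f`. -/
noncomputable def fiberEnergy (ψ : α → β) (f : α → ℝ) : ℝ := 𝔼 a, fiberMean ψ f a ^ 2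

theorem expect_sq_fiberMean_sub {ψ : α → β} {ψ' : α → γ} (h : ψ.FactorsThrough ψ') (f : α → ℝ) :
    𝔼 a, (fiberMean ψ' f a - fiberMean ψ f a) ^ 2 = fiberEnergy ψ' f - fiberEnergy ψ f := by
  have hcoarse : (fiberMean ψ f).FactorsThrough ψ' :=
    fun _ _ hab ↦ factorsThrough_fiberMean ψ f (h hab)
  have hcross : 𝔼 a, fiberMean ψ' f a * fiberMean ψ f a = fiberEnergy ψ f := by
    rw [expect_fiberMean_mul f hcoarse,
      ← expect_fiberMean_mul f (factorsThrough_fiberMean ψ f), fiberEnergy]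
    simp only [sq]
  have hexpand (a : α) : (fiberMean ψ' f a - fiberMean ψ f a) ^ 2 =
      fiberMean ψ' f a ^ 2 - 2 * (fiberMean ψ' f a * fiberMean ψ f a) + fiberMean ψ f a ^ 2 := by
    ring
  simp only [hexpand, expect_add_distrib, expect_sub_distrib, ← mul_expect, hcross]
  simp only [fiberEnergy]
  ring

theorem fiberEnergy_mono {ψ : α → β} {ψ' : α → γ} (h : ψ.FactorsThrough ψ') (f : α → ℝ) :
    fiberEnergy ψ f ≤ fiberEnergy ψ' f :=
  sub_nonneg.1 <| expect_sq_fiberMean_sub h f ▸ expect_nonneg fun _ _ ↦ sq_nonneg _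

theorem fiberEnergy_nonneg (ψ : α → β) (f : α → ℝ) : 0 ≤ fiberEnergy ψ f :=
  expect_nonneg fun _ _ ↦ sq_nonneg _

theorem fiberEnergy_le_expect_sq (ψ : α → β) (f : α → ℝ) : fiberEnergy ψ f ≤ 𝔼 a, f a ^ 2 := by
  classical
  simpa only [fiberEnergy, fiberMean_id] using fiberEnergy_mono (injective_id.factorsThrough ψ) f

theorem sq_expect_sub_fiberMean_mul_le {ψ : α → β} {ψ' : α → γ} (h : ψ.FactorsThrough ψ')
    (f : α → ℝ) {g : α → ℝ} (hg : g.FactorsThrough ψ') :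
    (𝔼 a, (f a - fiberMean ψ f a) * g a) ^ 2 ≤
      (fiberEnergy ψ' f - fiberEnergy ψ f) * 𝔼 a, g a ^ 2 := by
  have hrefine : 𝔼 a, (f a - fiberMean ψ f a) * g a =
      𝔼 a, (fiberMean ψ' f a - fiberMean ψ f a) * g a := by
    simp only [sub_mul, expect_sub_distrib, expect_fiberMean_mul f hg]
  rw [hrefine, ← expect_sq_fiberMean_sub h]
  exact expect_mul_sq_le_sq_mul_sq _ _ _

end FiberMean

section WeakRegularity

variable {V C : Type*} [Fintype V]

/-- The (normalised) cut norm of the kernel `U` is at most `ε`: its average over every rectangle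
`S ×ˢ T` is at most `ε` in absolute value. Rectangles are not rescaled, i.e. `𝔼` is over `V × V`. -/
def CutNormLE (U : V × V → ℝ) (ε : ℝ) : Prop :=
  ∀ S T : Set V, |𝔼 a, (S ×ˢ T).indicator U a| ≤ ε

theorem CutNormLE.neg {U : V × V → ℝ} {ε : ℝ} (hU : CutNormLE U ε) : CutNormLE (-U) ε :=
  fun S T ↦ by
    rw [Set.indicator_neg']
    simpa only [Pi.neg_apply, expect_neg_distrib, abs_neg] using hU S T

theorem exists_refinement_lt_fiberEnergy {k : ℕ} {π : V → Fin k} {U : V × V → ℝ} {ε : ℝ}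
    (hε : 0 < ε) (hU : ¬ CutNormLE (U - fiberMean (Prod.map π π) U) ε) :
    ∃ π' : V → Fin (k * 4), π.FactorsThrough π' ∧
      fiberEnergy (Prod.map π π) U + ε ^ 2 < fiberEnergy (Prod.map π' π') U := by
  classical
  simp only [CutNormLE, not_forall, not_le] at hU
  obtain ⟨S, T, hST⟩ := hU
  let e : Fin k × Bool × Bool ≃ Fin (k * 4) := Fintype.equivFinOfCardEq (by simp)
  let π' (v : V) : Fin (k * 4) := e (π v, decide (v ∈ S), decide (v ∈ T))
  have hπ' {u v : V} (h : π' u = π' v) : π u = π v ∧ (u ∈ S ↔ v ∈ S) ∧ (u ∈ T ↔ v ∈ T) := by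
    simpa [π'] using h
  have hrefine : (Prod.map π π).FactorsThrough (Prod.map π' π') := fun a b h ↦
    Prod.ext (hπ' (congrArg Prod.fst h)).1 (hπ' (congrArg Prod.snd h)).1
  refine ⟨π', fun _ _ h ↦ (hπ' h).1, ?_⟩
  set g : V × V → ℝ := (S ×ˢ T).indicator 1 with hg_def
  have hg : g.FactorsThrough (Prod.map π' π') := fun a b h ↦ by
    simp only [hg_def, Set.indicator_apply, Set.mem_prod, (hπ' (congrArg Prod.fst h)).2.1,
      (hπ' (congrArg Prod.snd h)).2.2, Pi.one_apply]
  have hg_sq : 𝔼 a, g a ^ 2 ≤ 1 := by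
    rcases isEmpty_or_nonempty V with _ | _
    · simp
    · refine expect_le univ_nonempty fun a _ ↦ ?_
      by_cases ha : a ∈ S ×ˢ T <;> simp [hg_def, ha]
  have hcut : ε ^ 2 < (𝔼 a, (U a - fiberMean (Prod.map π π) U a) * g a) ^ 2 := by
    have hindicator (a : V × V) : (U a - fiberMean (Prod.map π π) U a) * g a =
        (S ×ˢ T).indicator (U - fiberMean (Prod.map π π) U) a := by
      by_cases ha : a ∈ S ×ˢ T <;> simp [hg_def, ha]
    simp only [hindicator]
    rwa [sq_lt_sq, abs_of_pos hε]
  have hincrement := hcut.trans_le <| (sq_expect_sub_fiberMean_mul_le hrefine U hg).trans <|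
    mul_le_of_le_one_right (sub_nonneg.2 (fiberEnergy_mono hrefine U)) hg_sq
  linarith

theorem exists_refinement_lt_sum_fiberEnergy [Fintype C] {k : ℕ} {π : V → Fin k}
    {W : C → V × V → ℝ} {ε : ℝ} (hε : 0 < ε)
    (hW : ¬ ∀ c, CutNormLE (W c - fiberMean (Prod.map π π) (W c)) ε) :
    ∃ π' : V → Fin (k * 4), ∑ c, fiberEnergy (Prod.map π π) (W c) + ε ^ 2 <
      ∑ c, fiberEnergy (Prod.map π' π') (W c) := by
  classical
  obtain ⟨c, hc⟩ := not_forall.1 hW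
  obtain ⟨π', hrefine, hincrement⟩ := exists_refinement_lt_fiberEnergy hε hc
  refine ⟨π', ?_⟩
  have hmono (i : C) : fiberEnergy (Prod.map π π) (W i) ≤ fiberEnergy (Prod.map π' π') (W i) :=
    fiberEnergy_mono (fun _ _ h ↦ Prod.ext (hrefine (congrArg Prod.fst h))
      (hrefine (congrArg Prod.snd h))) _
  rw [← add_sum_erase _ _ (mem_univ c), ← add_sum_erase _ _ (mem_univ c)]
  linarith [sum_le_sum fun i (_ : i ∈ univ.erase c) ↦ hmono i]

theorem exists_weakRegular_partition [Fintype C] {W : C → V × V → ℝ}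
    (hW : ∑ c, 𝔼 a, W c a ^ 2 ≤ 1) {ε : ℝ} (hε : 0 < ε) {K : ℕ} (hK : 1 < K * ε ^ 2) :
    ∃ π : V → Fin (4 ^ K), ∀ c, CutNormLE (W c - fiberMean (Prod.map π π) (W c)) ε := by
  have hsteps (j : ℕ) : ∃ π : V → Fin (4 ^ j),
      (∀ c, CutNormLE (W c - fiberMean (Prod.map π π) (W c)) ε) ∨
        j * ε ^ 2 ≤ ∑ c, fiberEnergy (Prod.map π π) (W c) := by
    induction j with
    | zero => exact ⟨fun _ ↦ 0, .inr <| by simpa using sum_nonneg fun c _ ↦ fiberEnergy_nonneg _ _⟩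
    | succ j ih =>
      obtain ⟨π, hπ⟩ := ih
      by_cases hreg : ∀ c, CutNormLE (W c - fiberMean (Prod.map π π) (W c)) ε
      · let ι : Fin (4 ^ j) → Fin (4 ^ (j + 1)) :=
          Fin.castLE (Nat.pow_le_pow_right (by simp) (by simp))
        have hι : ι.Injective := Fin.castLE_injective _
        refine ⟨ι ∘ π, .inl fun c ↦ ?_⟩
        rw [← Prod.map_comp_map, fiberMean_comp_injective (hι.prodMap hι)]
        exact hreg c
      · obtain ⟨π', hπ'⟩ := exists_refinement_lt_sum_fiberEnergy hε hreg
        refine ⟨π', .inr (le_trans ?_ hπ'.le)⟩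
        push_cast
        linarith [hπ.resolve_left hreg]
  obtain ⟨π, hπ⟩ := hsteps K
  refine ⟨π, hπ.resolve_right fun henergy ↦ ?_⟩
  linarith [sum_le_sum fun c (_ : c ∈ univ) ↦ fiberEnergy_le_expect_sq (Prod.map π π) (W c)]

end WeakRegularity

section Counting

variable {V : Type*} [Fintype V]

theorem exists_expect_mul_le_expect_indicator (x : V → ℝ) {h : V → ℝ}
    (hh : ∀ v, h v ∈ Set.Icc 0 1) : ∃ S : Set V, 𝔼 v, x v * h v ≤ 𝔼 v, S.indicator x v := by
  refine ⟨{v | 0 < x v}, expect_le_expect fun v _ ↦ ?_⟩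
  by_cases hx : 0 < x v
  · simpa [hx] using mul_le_of_le_one_right hx.le (hh v).2
  · simpa [hx] using mul_nonpos_of_nonpos_of_nonneg (not_lt.1 hx) (hh v).1

/-- A bilinear form on `[0, 1]`-valued functions is maximal at a pair of indicators. -/
theorem CutNormLE.expect_mul_le {U : V × V → ℝ} {ε : ℝ} (hU : CutNormLE U ε) {f g : V → ℝ}
    (hf : ∀ v, f v ∈ Set.Icc 0 1) (hg : ∀ v, g v ∈ Set.Icc 0 1) :
    𝔼 u, 𝔼 v, U (u, v) * (f u * g v) ≤ ε := by
  classical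
  obtain ⟨S, hS⟩ := exists_expect_mul_le_expect_indicator (fun u ↦ 𝔼 v, U (u, v) * g v) hf
  obtain ⟨T, hT⟩ := exists_expect_mul_le_expect_indicator
    (fun v ↦ 𝔼 u, S.indicator (fun u ↦ U (u, v)) u) hg
  calc 𝔼 u, 𝔼 v, U (u, v) * (f u * g v)
      = 𝔼 u, (𝔼 v, U (u, v) * g v) * f u := by
        simp only [expect_mul]
        exact expect_congr rfl fun u _ ↦ expect_congr rfl fun v _ ↦ by ring
    _ ≤ 𝔼 u, S.indicator (fun u ↦ 𝔼 v, U (u, v) * g v) u := hS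
    _ = 𝔼 v, (𝔼 u, S.indicator (fun u ↦ U (u, v)) u) * g v := by
        simp only [expect_mul, Set.indicator_apply, ite_mul, zero_mul]
        rw [expect_comm]
        congr! 2 with u
        split_ifs <;> simp
    _ ≤ 𝔼 v, T.indicator (fun v ↦ 𝔼 u, S.indicator (fun u ↦ U (u, v)) u) v := hT
    _ = 𝔼 a, (S ×ˢ T).indicator U a := by
        rw [← univ_product_univ, expect_product, expect_comm]
        congr! 2 with v
        by_cases hv : v ∈ T <;> simp [Set.indicator_apply, hv]
    _ ≤ ε := (le_abs_self _).trans (hU S T)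

theorem CutNormLE.abs_expect_mul_le {U : V × V → ℝ} {ε : ℝ} (hU : CutNormLE U ε) {f g : V → ℝ}
    (hf : ∀ v, f v ∈ Set.Icc 0 1) (hg : ∀ v, g v ∈ Set.Icc 0 1) :
    |𝔼 u, 𝔼 v, U (u, v) * (f u * g v)| ≤ ε := by
  refine abs_le'.2 ⟨hU.expect_mul_le hf hg, ?_⟩
  simpa [neg_mul, expect_neg_distrib] using hU.neg.expect_mul_le hf hg

/-- The density of triangles whose edges are weighted by the three kernels `x`, `y`, `z`. -/
noncomputable def triangleDensity (x y z : V × V → ℝ) : ℝ :=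
  𝔼 u, 𝔼 v, 𝔼 w, x (u, v) * y (v, w) * z (u, w)

theorem triangleDensity_sub_triangleDensity (x y z x' y' z' : V × V → ℝ) :
    triangleDensity x y z - triangleDensity x' y' z' =
      𝔼 w, 𝔼 u, 𝔼 v, (x - x') (u, v) * (z (u, w) * y (v, w)) +
      𝔼 u, 𝔼 v, 𝔼 w, (y - y') (v, w) * (x' (u, v) * z (u, w)) +
      𝔼 v, 𝔼 u, 𝔼 w, (z - z') (u, w) * (x' (u, v) * y' (v, w)) := by
  have hrotate (f : V → V → V → ℝ) : 𝔼 w, 𝔼 u, 𝔼 v, f u v w = 𝔼 u, 𝔼 v, 𝔼 w, f u v w := by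
    rw [expect_comm]
    exact expect_congr rfl fun u _ ↦ expect_comm ..
  rw [hrotate fun u v w ↦ (x - x') (u, v) * (z (u, w) * y (v, w)),
    expect_comm (f := fun v u ↦ 𝔼 w, (z - z') (u, w) * (x' (u, v) * y' (v, w)))]
  simp only [triangleDensity, ← expect_add_distrib, ← expect_sub_distrib, Pi.sub_apply]
  exact expect_congr rfl fun u _ ↦ expect_congr rfl fun v _ ↦ expect_congr rfl fun w _ ↦ by ring

theorem abs_triangleDensity_sub_le [Nonempty V] {C : Type*} {W q : C → V × V → ℝ} {ε : ℝ}
    (hW : ∀ c a, W c a ∈ Set.Icc 0 1) (hq : ∀ c a, q c a ∈ Set.Icc 0 1)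
    (h : ∀ c, CutNormLE (W c - q c) ε) (a b c : C) :
    |triangleDensity (W a) (W b) (W c) - triangleDensity (q a) (q b) (q c)| ≤ 3 * ε := by
  have hmean {F : V → ℝ} (hF : ∀ v, |F v| ≤ ε) : |𝔼 v, F v| ≤ ε :=
    (abs_expect_le _ _).trans (expect_le univ_nonempty fun v _ ↦ hF v)
  rw [triangleDensity_sub_triangleDensity]
  refine (abs_add_three _ _ _).trans ?_
  have hab := hmean fun w ↦ (h a).abs_expect_mul_le (fun u ↦ hW c (u, w)) fun v ↦ hW b (v, w)
  have hbc := hmean fun u ↦ (h b).abs_expect_mul_le (fun v ↦ hq a (u, v)) fun w ↦ hW c (u, w)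
  have hac := hmean fun v ↦ (h c).abs_expect_mul_le (fun u ↦ hq a (u, v)) fun w ↦ hq b (v, w)
  linarith

end Counting

section Palettes

variable {α β C : Type*} [DecidableEq C]

/-- The indicator function of the `c`-coloured points of the colouring `χ`. -/
def colorIndicator (χ : α → C) (c : C) (a : α) : ℝ := if χ a = c then 1 else 0

theorem colorIndicator_mem_Icc (χ : α → C) (c : C) (a : α) :
    colorIndicator χ c a ∈ Set.Icc 0 1 := by
  unfold colorIndicator
  split_ifs <;> simp

variable [Fintype α] [DecidableEq β]

/-- The proportion of the colour `c` in the fibre of `ψ` through a given point. -/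
noncomputable def colorDensity (ψ : α → β) (χ : α → C) (c : C) : α → ℝ :=
  fiberMean ψ (colorIndicator χ c)

theorem colorDensity_mem_Icc (ψ : α → β) (χ : α → C) (c : C) (a : α) :
    colorDensity ψ χ c a ∈ Set.Icc 0 1 :=
  fiberMean_mem_Icc ψ (colorIndicator_mem_Icc χ c) a

variable [Fintype C]

theorem sum_colorDensity (ψ : α → β) (χ : α → C) (a : α) :
    ∑ c, colorDensity ψ χ c a = 1 := by
  have hindicator : ∑ c, colorIndicator χ c = 1 := by
    ext a
    simp [colorIndicator]
  rw [← Finset.sum_apply]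
  simp only [colorDensity]
  rw [sum_fiberMean, hindicator, fiberMean_one, Pi.one_apply]

/-- The colours making up a proportion at least `η` of the fibre of `ψ` through `a`. -/
noncomputable def fiberPalette (ψ : α → β) (χ : α → C) (η : ℝ) (a : α) : Finset C :=
  {c | η ≤ colorDensity ψ χ c a}

theorem mem_fiberPalette {ψ : α → β} {χ : α → C} {η : ℝ} {a : α} {c : C} :
    c ∈ fiberPalette ψ χ η a ↔ η ≤ colorDensity ψ χ c a := by
  simp [fiberPalette]

theorem fiberPalette_nonempty [Nonempty C] (ψ : α → β) (χ : α → C) {η : ℝ}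
    (hη : Fintype.card C * η ≤ 1) (a : α) : (fiberPalette ψ χ η a).Nonempty := by
  by_contra! hempty
  have hlt (c : C) : colorDensity ψ χ c a < η := by
    rw [← not_le, ← mem_fiberPalette, hempty]
    exact notMem_empty c
  have := sum_lt_sum_of_nonempty univ_nonempty fun c _ ↦ hlt c
  simp only [sum_colorDensity, sum_const, card_univ, nsmul_eq_mul] at this
  linarith

theorem factorsThrough_fiberPalette (ψ : α → β) (χ : α → C) (η : ℝ) :
    (fiberPalette ψ χ η).FactorsThrough ψ := fun a b h ↦ by
  ext c
  simp only [mem_fiberPalette, colorDensity, factorsThrough_fiberMean ψ _ h]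

theorem expect_notMem_fiberPalette_le [Nonempty α] (ψ : α → β) (χ : α → C) {η : ℝ} (hη : 0 ≤ η) :
    𝔼 a, (if χ a ∈ fiberPalette ψ χ η a then 0 else 1 : ℝ) ≤ Fintype.card C * η := by
  let rare (c : C) (a : α) : ℝ := if c ∈ fiberPalette ψ χ η a then 0 else 1
  have hrare (c : C) : (rare c).FactorsThrough ψ := fun a b h ↦ by
    simp only [rare, factorsThrough_fiberPalette ψ χ η h]
  calc 𝔼 a, (if χ a ∈ fiberPalette ψ χ η a then 0 else 1 : ℝ)
      = ∑ c, 𝔼 a, colorIndicator χ c a * rare c a := by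
        simp only [← expect_sum_comm, colorIndicator, rare, ite_mul, one_mul, zero_mul]
        simp
    _ = ∑ c, 𝔼 a, colorDensity ψ χ c a * rare c a :=
        sum_congr rfl fun c _ ↦ (expect_fiberMean_mul _ (hrare c)).symm
    _ ≤ ∑ _c : C, η := by
        refine sum_le_sum fun c _ ↦ expect_le univ_nonempty fun a _ ↦ ?_
        by_cases hc : η ≤ colorDensity ψ χ c a
        · simpa [rare, mem_fiberPalette, hc] using hη
        · simpa [rare, mem_fiberPalette, hc] using (not_le.1 hc).le
    _ = Fintype.card C * η := by simp

end Palettes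

section Containers

variable {V β C : Type*}

/-- Every choice of a colour from each of `A`, `B`, `D` gives a triple related by `R`. -/
def AllRelated (R : C → C → C → Prop) (A B D : Finset C) : Prop :=
  ∀ a ∈ A, ∀ b ∈ B, ∀ c ∈ D, R a b c

open scoped Classical in
theorem pow_mul_ite_allRelated_le [Fintype C] {R : C → C → C → Prop} {A B D : Finset C}
    {x y z : C → ℝ} {η : ℝ} (hη : 0 ≤ η) (hx : 0 ≤ x) (hy : 0 ≤ y) (hz : 0 ≤ z)
    (hA : ∀ a ∈ A, η ≤ x a) (hB : ∀ b ∈ B, η ≤ y b) (hD : ∀ c ∈ D, η ≤ z c) :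
    η ^ 3 * (if AllRelated R A B D then 0 else 1 : ℝ) ≤
      ∑ t : C × C × C with ¬ R t.1 t.2.1 t.2.2, x t.1 * y t.2.1 * z t.2.2 := by
  have hnonneg (t : C × C × C) : 0 ≤ x t.1 * y t.2.1 * z t.2.2 :=
    mul_nonneg (mul_nonneg (hx _) (hy _)) (hz _)
  split_ifs with hrel
  · simpa using sum_nonneg fun t _ ↦ hnonneg t
  · simp only [AllRelated, not_forall] at hrel
    obtain ⟨a, ha, b, hb, c, hc, hbad⟩ := hrel
    calc η ^ 3 * 1 = η * η * η := by ring
      _ ≤ x a * y b * z c :=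
          mul_le_mul (mul_le_mul (hA a ha) (hB b hb) hη (hx a)) (hD c hc) hη
            (mul_nonneg (hx a) (hy b))
      _ ≤ _ := single_le_sum (f := fun t ↦ x t.1 * y t.2.1 * z t.2.2)
          (fun t _ ↦ hnonneg t) (a := (a, b, c)) (by simpa using hbad)

variable [Fintype V] [DecidableEq β] [DecidableEq C]

theorem triangleDensity_colorDensity_le [Nonempty V] {ψ : V × V → β} {χ : V × V → C}
    {R : C → C → C → Prop} (hR : ∀ u v w, R (χ (u, v)) (χ (v, w)) (χ (u, w))) {ε : ℝ}
    (hψ : ∀ c, CutNormLE (colorIndicator χ c - colorDensity ψ χ c) ε) {a b c : C}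
    (habc : ¬ R a b c) :
    triangleDensity (colorDensity ψ χ a) (colorDensity ψ χ b) (colorDensity ψ χ c) ≤ 3 * ε := by
  have hzero : triangleDensity (colorIndicator χ a) (colorIndicator χ b) (colorIndicator χ c) =
      0 := by
    refine expect_eq_zero fun u _ ↦ expect_eq_zero fun v _ ↦ expect_eq_zero fun w _ ↦ ?_
    have := hR u v w
    simp only [colorIndicator]
    grind
  have hcount := abs_triangleDensity_sub_le (colorIndicator_mem_Icc χ) (colorDensity_mem_Icc ψ χ)
    hψ a b c
  rw [hzero, zero_sub, abs_neg] at hcount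
  exact (le_abs_self _).trans hcount

variable [Fintype C]

open scoped Classical in
theorem expect_not_allRelated_fiberPalette_le [Nonempty V] {ψ : V × V → β} {χ : V × V → C}
    {R : C → C → C → Prop} (hR : ∀ u v w, R (χ (u, v)) (χ (v, w)) (χ (u, w))) {ε η : ℝ}
    (hε : 0 ≤ ε) (hη : 0 < η)
    (hψ : ∀ c, CutNormLE (colorIndicator χ c - colorDensity ψ χ c) ε) :
    𝔼 u, 𝔼 v, 𝔼 w, (if AllRelated R (fiberPalette ψ χ η (u, v)) (fiberPalette ψ χ η (v, w))
      (fiberPalette ψ χ η (u, w)) then 0 else 1 : ℝ) ≤ 3 * Fintype.card C ^ 3 * ε / η ^ 3 := by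
  let q := colorDensity ψ χ
  have hq (a : V × V) : 0 ≤ (q · a) := fun c ↦ (colorDensity_mem_Icc ψ χ c a).1
  have hpalette (a : V × V) : ∀ c ∈ fiberPalette ψ χ η a, η ≤ q c a := fun c ↦ mem_fiberPalette.1
  rw [le_div_iff₀' (by positivity)]
  simp only [mul_expect]
  calc _ ≤ 𝔼 u, 𝔼 v, 𝔼 w, ∑ t : C × C × C with ¬ R t.1 t.2.1 t.2.2,
          q t.1 (u, v) * q t.2.1 (v, w) * q t.2.2 (u, w) := by
        gcongr with u _ v _ w _
        exact pow_mul_ite_allRelated_le hη.le (hq _) (hq _) (hq _) (hpalette _) (hpalette _)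
          (hpalette _)
    _ = ∑ t : C × C × C with ¬ R t.1 t.2.1 t.2.2,
          triangleDensity (q t.1) (q t.2.1) (q t.2.2) := by
        simp only [triangleDensity, expect_sum_comm]
    _ ≤ ∑ t : C × C × C with ¬ R t.1 t.2.1 t.2.2, 3 * ε :=
        sum_le_sum fun t ht ↦ triangleDensity_colorDensity_le hR hψ (mem_filter.1 ht).2
    _ ≤ ∑ t : C × C × C, 3 * ε :=
        sum_le_sum_of_subset_of_nonneg (subset_univ _) fun _ _ _ ↦ by positivity
    _ = 3 * Fintype.card C ^ 3 * ε := by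
        simp only [sum_const, card_univ, Fintype.card_prod, nsmul_eq_mul]
        push_cast
        ring

theorem fiberPalette_swap (π : V → β) (χ : Sym2 V → C) (η : ℝ) (u v : V) :
    fiberPalette (Prod.map π π) (fun a ↦ χ s(a.1, a.2)) η (u, v) =
      fiberPalette (Prod.map π π) (fun a ↦ χ s(a.1, a.2)) η (v, u) := by
  ext c
  have hswap := fiberMean_comp_equiv (ψ := Prod.map π π) (e := Equiv.prodComm V V)
    (f := colorIndicator (fun a ↦ χ s(a.1, a.2)) c) (by simp [Prod.ext_iff, and_comm]) (v, u)
  have hsymm : colorIndicator (fun a ↦ χ s(a.1, a.2)) c ∘ Equiv.prodComm V V =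
      colorIndicator (fun a ↦ χ s(a.1, a.2)) c := by
    ext a
    simp [colorIndicator, Sym2.eq_swap]
  rw [hsymm] at hswap
  simp only [mem_fiberPalette, colorDensity, ← hswap, Equiv.prodComm_apply, Prod.swap_prod_mk]

theorem exists_fiberPalette_eq (π : V → β) (χ : Sym2 V → C) (η : ℝ) :
    ∃ P : Sym2 β → Finset C, ∀ u v,
      fiberPalette (Prod.map π π) (fun a ↦ χ s(a.1, a.2)) η (u, v) = P s(π u, π v) := by
  let palette := fiberPalette (Prod.map π π) (fun a ↦ χ s(a.1, a.2)) η
  have hfactors : palette.FactorsThrough fun a ↦ s(π a.1, π a.2) := by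
    rintro ⟨u, v⟩ ⟨u', v'⟩ h
    rcases Sym2.eq_iff.1 h with ⟨hu, hv⟩ | ⟨hu, hv⟩
    · exact factorsThrough_fiberPalette _ _ _ (Prod.ext hu hv)
    · exact (factorsThrough_fiberPalette _ _ _ (Prod.ext hu hv)).trans
        (fiberPalette_swap π χ η v' u')
  exact ⟨Function.extend (fun a ↦ s(π a.1, π a.2)) palette fun _ ↦ ∅,
    fun u v ↦ (hfactors.extend_apply _ (u, v)).symm⟩

open scoped Classical in
theorem exists_palettes (C : Type*) [Finite C] [Nonempty C] {δ : ℝ} (hδ : 0 < δ) :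
    ∃ M : ℕ, ∀ {V : Type*} [Fintype V] [Nonempty V] (χ : Sym2 V → C) (R : C → C → C → Prop),
      (∀ u v w, R (χ s(u, v)) (χ s(v, w)) (χ s(u, w))) →
      ∃ (π : V → Fin M) (P : Sym2 (Fin M) → Finset C), (∀ u v, (P s(π u, π v)).Nonempty) ∧
        𝔼 u, 𝔼 v, (if χ s(u, v) ∈ P s(π u, π v) then 0 else 1 : ℝ) ≤ δ ∧
        𝔼 u, 𝔼 v, 𝔼 w, (if AllRelated R (P s(π u, π v)) (P s(π v, π w)) (P s(π u, π w))
          then 0 else 1 : ℝ) ≤ δ := by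
  cases nonempty_fintype C
  have : (0 : ℝ) < Fintype.card C := by exact_mod_cast Fintype.card_pos
  obtain ⟨η, hη, hηδ, hη1⟩ : ∃ η : ℝ, 0 < η ∧ Fintype.card C * η ≤ δ ∧ Fintype.card C * η ≤ 1 :=
    ⟨min δ 1 / Fintype.card C, by positivity, by field_simp; simp, by field_simp; simp⟩
  obtain ⟨ε, hε, hεδ⟩ : ∃ ε : ℝ, 0 < ε ∧ 3 * Fintype.card C ^ 3 * ε / η ^ 3 = δ :=
    ⟨η ^ 3 * δ / (3 * Fintype.card C ^ 3), by positivity, by field_simp⟩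
  obtain ⟨K, hK⟩ := exists_nat_gt (1 / ε ^ 2)
  refine ⟨4 ^ K, fun {V} _ _ χ R hR ↦ ?_⟩
  let χ' (a : V × V) : C := χ s(a.1, a.2)
  have henergy : ∑ c, 𝔼 a, colorIndicator χ' c a ^ 2 ≤ 1 := by
    rw [← expect_sum_comm]
    simp [colorIndicator]
  obtain ⟨π, hπ⟩ := exists_weakRegular_partition henergy hε ((div_lt_iff₀ (by positivity)).1 hK)
  obtain ⟨P, hP⟩ := exists_fiberPalette_eq π χ η
  have hrare := expect_notMem_fiberPalette_le (Prod.map π π) χ' hη.le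
  rw [← univ_product_univ, expect_product] at hrare
  have hbad := expect_not_allRelated_fiberPalette_le (χ := χ') hR hε.le hη hπ
  simp only [χ', hP] at hrare hbad
  exact ⟨π, P, fun u v ↦ hP u v ▸ fiberPalette_nonempty _ _ hη1 _, hrare.trans hηδ,
    hbad.trans_eq hεδ⟩

end Containers

section RoundedTriangles

/-- The triangle inequality, up to an error of one, between three numbers of `{0, ..., N}`. -/
def IsRoundedTriangle {N : ℕ} (a b c : Fin (N + 1)) : Prop :=
  (c : ℕ) ≤ a + b + 1 ∧ (a : ℕ) ≤ b + c + 1 ∧ (b : ℕ) ≤ a + c + 1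

theorem card_add_min'_le_max'_add_one {N : ℕ} {A : Finset (Fin (N + 1))} (hA : A.Nonempty) :
    #A + A.min' hA ≤ (A.max' hA : ℕ) + 1 := by
  have hcard : #A ≤ #(Icc (A.min' hA) (A.max' hA)) :=
    card_le_card fun a ha ↦ mem_Icc.2 ⟨A.min'_le a ha, A.le_max' a ha⟩
  rw [Fin.card_Icc] at hcard
  have := hA.card_pos
  omega

/-- Apply the inequality to the largest element of one set and the smallest elements of the other
two, in all three ways. -/
theorem card_add_card_add_card_le {N : ℕ} {A B D : Finset (Fin (N + 1))} (hA : A.Nonempty)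
    (hB : B.Nonempty) (hD : D.Nonempty) (h : AllRelated IsRoundedTriangle A B D) :
    2 * (#A + #B + #D) ≤ 3 * (N + 1) + 6 := by
  have hmaxD := (h _ (A.min'_mem hA) _ (B.min'_mem hB) _ (D.max'_mem hD)).1
  have hmaxA := (h _ (A.max'_mem hA) _ (B.min'_mem hB) _ (D.min'_mem hD)).2.1
  have hmaxB := (h _ (A.min'_mem hA) _ (B.max'_mem hB) _ (D.min'_mem hD)).2.2
  have := card_add_min'_le_max'_add_one hA
  have := card_add_min'_le_max'_add_one hB
  have := card_add_min'_le_max'_add_one hD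
  have := hA.card_pos
  have := hB.card_pos
  have := hD.card_pos
  have := (A.max' hA).is_lt
  have := (B.max' hB).is_lt
  have := (D.max' hD).is_lt
  omega

open scoped Classical in
theorem expect_card_palette_le {V : Type*} [Fintype V] [Nonempty V] {N : ℕ}
    {Q : V → V → Finset (Fin (N + 1))} (hQ : ∀ u v, (Q u v).Nonempty) {δ : ℝ}
    (hδ : 𝔼 u, 𝔼 v, 𝔼 w, (if AllRelated IsRoundedTriangle (Q u v) (Q v w) (Q u w)
      then 0 else 1 : ℝ) ≤ δ) :
    𝔼 u, 𝔼 v, (#(Q u v) / (N + 1) : ℝ) ≤ 1 / 2 + 1 / (N + 1) + δ := by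
  have hpointwise (u v w : V) : (#(Q u v) / (N + 1) + #(Q v w) / (N + 1) + #(Q u w) / (N + 1) : ℝ) ≤
      3 * (1 / 2 + 1 / (N + 1)) +
        3 * if AllRelated IsRoundedTriangle (Q u v) (Q v w) (Q u w) then 0 else 1 := by
    split_ifs with h
    · have := card_add_card_add_card_le (hQ u v) (hQ v w) (hQ u w) h
      have : (2 * (#(Q u v) + #(Q v w) + #(Q u w)) : ℝ) ≤ 3 * (N + 1) + 6 := by exact_mod_cast this
      field_simp
      linarith
    · have hone (x y : V) : (#(Q x y) / (N + 1) : ℝ) ≤ 1 := by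
        rw [div_le_one (by positivity)]
        exact_mod_cast (card_le_univ (Q x y)).trans_eq (Fintype.card_fin _)
      have : (0 : ℝ) ≤ 1 / (N + 1) := by positivity
      linarith [hone u v, hone v w, hone u w]
  have haverage := expect_le_expect fun u (_ : u ∈ univ) ↦ expect_le_expect fun v (_ : v ∈ univ) ↦
    expect_le_expect fun w (_ : w ∈ univ) ↦ hpointwise u v w
  simp only [expect_add_distrib, ← mul_expect, expect_const univ_nonempty] at haverage
  linarith

theorem exists_small_palettes (N : ℕ) {δ : ℝ} (hδ : 0 < δ) :
    ∃ M : ℕ, ∀ {V : Type*} [Fintype V] [Nonempty V] (χ : Sym2 V → Fin (N + 1)),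
      (∀ u v w, IsRoundedTriangle (χ s(u, v)) (χ s(v, w)) (χ s(u, w))) →
      ∃ (π : V → Fin M) (P : Sym2 (Fin M) → Finset (Fin (N + 1))),
        𝔼 u, 𝔼 v, (if χ s(u, v) ∈ P s(π u, π v) then 0 else 1 : ℝ) ≤ δ ∧
        𝔼 u, 𝔼 v, (#(P s(π u, π v)) / (N + 1) : ℝ) ≤ 1 / 2 + 1 / (N + 1) + δ := by
  classical
  obtain ⟨M, hM⟩ := exists_palettes (Fin (N + 1)) hδ
  refine ⟨M, fun χ hχ ↦ ?_⟩
  obtain ⟨π, P, hP, hcover, hbad⟩ := hM χ IsRoundedTriangle hχ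
  exact ⟨π, P, by convert hcover, expect_card_palette_le hP hbad⟩

end RoundedTriangles

section Grid

/-- The index of the cell of `[0, 1]` containing `x`, when the unit interval is cut into `N + 1`
cells of equal length. The truncation at `N` puts the endpoint `1` in the last cell. -/
noncomputable def gridColor (N : ℕ) (x : ℝ) : Fin (N + 1) :=
  ⟨min N ⌊(N + 1) * x⌋₊, by omega⟩

theorem measurable_gridColor (N : ℕ) : Measurable (gridColor N) :=
  (measurable_from_nat (f := fun m ↦ (⟨min N m, by omega⟩ : Fin (N + 1)))).comp
    (Nat.measurable_floor.comp (measurable_const_mul _))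

theorem measurableSet_gridColor_mem {N : ℕ} (A : Finset (Fin (N + 1))) :
    MeasurableSet {x | gridColor N x ∈ A} :=
  measurable_gridColor N A.measurableSet

theorem gridColor_le_add {N : ℕ} {x y z : ℝ} (hx : 0 ≤ x) (hxyz : x ≤ y + z) :
    (gridColor N x : ℕ) ≤ gridColor N y + gridColor N z + 1 := by
  have hfloor : ⌊(N + 1) * x⌋₊ < ⌊(N + 1) * y⌋₊ + ⌊(N + 1) * z⌋₊ + 2 := by
    rw [Nat.floor_lt (by positivity)]
    push_cast
    nlinarith [Nat.lt_floor_add_one ((N + 1) * y), Nat.lt_floor_add_one ((N + 1) * z)]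
  simp only [gridColor]
  omega

theorem mem_Icc_of_gridColor {N : ℕ} {x : ℝ} (hx : x ∈ Set.Icc 0 1) :
    x ∈ Set.Icc ((gridColor N x : ℝ) / (N + 1)) ((gridColor N x + 1 : ℝ) / (N + 1)) := by
  have hlower := Nat.floor_le (mul_nonneg N.cast_add_one_pos.le hx.1)
  have hupper := Nat.lt_floor_add_one ((N + 1) * x)
  have hcell : (gridColor N x : ℕ) = min N ⌊(N + 1) * x⌋₊ := rfl
  rw [Set.mem_Icc, div_le_iff₀' N.cast_add_one_pos, le_div_iff₀' N.cast_add_one_pos, hcell]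
  rcases min_cases N ⌊(N + 1) * x⌋₊ with ⟨h, hle⟩ | ⟨h, -⟩
  · rw [h]
    exact ⟨(Nat.cast_le.2 hle).trans hlower, mul_le_of_le_one_right N.cast_add_one_pos.le hx.2⟩
  · rw [h]
    exact ⟨hlower, hupper.le⟩

theorem measureReal_gridColor_mem_le {N : ℕ} (A : Finset (Fin (N + 1))) :
    (volume.restrict (Set.Icc (0 : ℝ) 1)).real {x | gridColor N x ∈ A} ≤ #A / (N + 1) := by
  have hcover : {x | gridColor N x ∈ A} ∩ Set.Icc 0 1 ⊆
      ⋃ c ∈ A, Set.Icc ((c : ℝ) / (N + 1)) ((c + 1 : ℝ) / (N + 1)) :=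
    fun x hx ↦ Set.mem_biUnion hx.1 (mem_Icc_of_gridColor hx.2)
  have hcell (c : Fin (N + 1)) :
      volume.real (Set.Icc ((c : ℝ) / (N + 1)) ((c + 1 : ℝ) / (N + 1))) = 1 / (N + 1) := by
    rw [Real.volume_real_Icc_of_le (by gcongr; simp)]
    ring
  rw [measureReal_restrict_apply (measurableSet_gridColor_mem A)]
  calc _ ≤ ∑ c ∈ A, volume.real (Set.Icc ((c : ℝ) / (N + 1)) ((c + 1 : ℝ) / (N + 1))) :=
        (measureReal_mono hcover (A.isCompact_biUnion fun _ _ ↦ isCompact_Icc).measure_ne_top).trans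
          (measureReal_biUnion_finset_le _ _)
    _ = #A / (N + 1) := by
        simp only [hcell, sum_const, nsmul_eq_mul, mul_one_div]

end Grid

section ProductMeasures

variable {ι : Type*} [Fintype ι]

open scoped Classical in
/-- Markov's inequality for the exponential moment `∏ i, exp (-L * 1_{d i ∉ B i})`. -/
theorem measureReal_pi_card_notMem_le {Ω : ι → Type*} [∀ i, MeasurableSpace (Ω i)]
    (μ : ∀ i, Measure (Ω i)) [∀ i, IsProbabilityMeasure (μ i)] {B : ∀ i, Set (Ω i)}
    (hB : ∀ i, MeasurableSet (B i)) {L : ℝ} (hL : 0 ≤ L) (m : ℝ) :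
    (Measure.pi μ).real {d | (#{i | d i ∉ B i} : ℝ) ≤ m} ≤
      Real.exp (L * m) * ∏ i, (Real.exp (-L) + (μ i).real (B i)) := by
  let weight (i : ι) (x : Ω i) : ℝ := Real.exp (-L) + (B i).indicator 1 x
  have hweight (i : ι) (x : Ω i) : (if x ∉ B i then Real.exp (-L) else 1) ≤ weight i x := by
    by_cases hx : x ∈ B i <;> simp [weight, hx, (Real.exp_pos _).le]
  have hmoment (d : ∀ i, Ω i) (hd : (#{i | d i ∉ B i} : ℝ) ≤ m) :
      Real.exp (-(L * m)) ≤ ∏ i, weight i (d i) :=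
    calc Real.exp (-(L * m)) ≤ Real.exp (-L) ^ #{i | d i ∉ B i} := by
          rw [← Real.exp_nat_mul, Real.exp_le_exp]
          nlinarith
      _ = ∏ i, if d i ∉ B i then Real.exp (-L) else 1 := by
          rw [← prod_filter, prod_const]
      _ ≤ ∏ i, weight i (d i) :=
          prod_le_prod (fun i _ ↦ by positivity) fun i _ ↦ hweight i (d i)
  have hindicator (i : ι) : Integrable ((B i).indicator 1 : Ω i → ℝ) (μ i) :=
    (integrable_const 1).indicator (hB i)
  have hintegrable : Integrable (fun d ↦ ∏ i, weight i (d i)) (Measure.pi μ) :=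
    .fintype_prod_dep fun i ↦ (integrable_const _).add (hindicator i)
  have hmean (i : ι) : ∫ x, weight i x ∂μ i = Real.exp (-L) + (μ i).real (B i) := by
    rw [integral_add (integrable_const _) (hindicator i), integral_indicator_one (hB i)]
    simp
  have hmarkov := mul_meas_ge_le_integral_of_nonneg (.of_forall fun d ↦ prod_nonneg fun i _ ↦
    le_trans (by positivity) (hweight i (d i))) hintegrable (Real.exp (-(L * m)))
  rw [integral_fintype_prod_eq_prod, Real.exp_neg, inv_mul_le_iff₀ (Real.exp_pos _),
    ← Real.exp_neg] at hmarkov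
  simp only [hmean] at hmarkov
  exact (measureReal_mono hmoment).trans hmarkov

theorem prod_le_half_pow_mul_exp {x : ι → ℝ} (hx : ∀ i, 0 ≤ x i) :
    ∏ i, x i ≤ (1 / 2) ^ Fintype.card ι * Real.exp (2 * ∑ i, x i - Fintype.card ι) := by
  have hfactor (i : ι) : x i ≤ 1 / 2 * Real.exp (2 * x i - 1) := by
    linarith [Real.add_one_le_exp (2 * x i - 1)]
  calc ∏ i, x i ≤ ∏ i, 1 / 2 * Real.exp (2 * x i - 1) :=
        prod_le_prod (fun i _ ↦ hx i) fun i _ ↦ hfactor i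
    _ = _ := by
        rw [prod_mul_distrib, ← Real.exp_sum, sum_sub_distrib, ← mul_sum]
        simp

end ProductMeasures

section Edges

theorem card_completeEdge (n : ℕ) : Fintype.card (CompleteEdge n) = n.choose 2 := by
  classical
  rw [← SimpleGraph.edgeFinset_card, SimpleGraph.card_edgeFinset_top_eq_card_choose_two,
    Fintype.card_fin]

theorem two_mul_sum_edgeSet_le {V : Type*} [Fintype V] (G : SimpleGraph V) [Fintype G.edgeSet]
    {F : Sym2 V → ℝ} (hF : 0 ≤ F) : 2 * ∑ e : G.edgeSet, F e ≤ ∑ u, ∑ v, F s(u, v) := by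
  classical
  let toEdge (a : G.Dart) : G.edgeSet := ⟨a.edge, a.edge_mem⟩
  have hfiber (e : G.edgeSet) : #{a | toEdge a = e} = 2 := by
    simpa [toEdge, Subtype.ext_iff] using G.dart_edge_fiber_card e e.2
  calc 2 * ∑ e : G.edgeSet, F e = ∑ e : G.edgeSet, ∑ a with toEdge a = e, F a.edge := by
        rw [mul_sum]
        refine sum_congr rfl fun e _ ↦ ?_
        rw [sum_congr rfl fun a ha ↦ congrArg (F ·.1) (mem_filter.1 ha).2, sum_const, hfiber]
        simp
    _ = ∑ a : G.Dart, F s(a.fst, a.snd) := sum_fiberwise ..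
    _ = ∑ a ∈ univ.map ⟨_, SimpleGraph.Dart.toProd_injective (G := G)⟩, F s(a.1, a.2) := by
        rw [sum_map]
        rfl
    _ ≤ ∑ a : V × V, F s(a.1, a.2) :=
        sum_le_sum_of_subset_of_nonneg (subset_univ _) fun a _ _ ↦ hF _
    _ = ∑ u, ∑ v, F s(u, v) := Fintype.sum_prod_type _

/-- The values of `d` as a function on all unordered pairs, with value `0` on the diagonal. -/
noncomputable def edgeDist {n : ℕ} (d : CompleteEdge n → ℝ) : Sym2 (Fin n) → ℝ :=
  Function.extend Subtype.val d 0

variable {n : ℕ} {d : CompleteEdge n → ℝ}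

theorem edgeDist_coe (d : CompleteEdge n → ℝ) (e : CompleteEdge n) : edgeDist d e = d e :=
  Subtype.val_injective.extend_apply ..

theorem edgeDist_of_ne (d : CompleteEdge n → ℝ) {u v : Fin n} (h : u ≠ v) :
    edgeDist d s(u, v) = d (completeEdge u v h) :=
  edgeDist_coe d (completeEdge u v h)

theorem edgeDist_self (d : CompleteEdge n → ℝ) (u : Fin n) : edgeDist d s(u, u) = 0 :=
  extend_apply' _ _ _ <| by simp

theorem edgeDist_mem_Icc (hd : d ∈ metricPolytope n) (u v : Fin n) :
    edgeDist d s(u, v) ∈ Set.Icc 0 1 := by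
  rcases eq_or_ne u v with rfl | h
  · simp [edgeDist_self]
  · exact edgeDist_of_ne d h ▸ hd.1 _

theorem edgeDist_triangle (hd : d ∈ metricPolytope n) (u v w : Fin n) :
    edgeDist d s(u, w) ≤ edgeDist d s(u, v) + edgeDist d s(v, w) := by
  rcases eq_or_ne u v with rfl | huv
  · simp [edgeDist_self]
  rcases eq_or_ne v w with rfl | hvw
  · simp [edgeDist_self]
  rcases eq_or_ne u w with rfl | huw
  · rw [edgeDist_self]
    exact add_nonneg (edgeDist_mem_Icc hd u v).1 (edgeDist_mem_Icc hd v u).1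
  simpa only [edgeDist_of_ne d huv, edgeDist_of_ne d hvw, edgeDist_of_ne d huw] using
    hd.2 u v w huv hvw huw

theorem isRoundedTriangle_gridColor_edgeDist (N : ℕ) (hd : d ∈ metricPolytope n) (u v w : Fin n) :
    IsRoundedTriangle (gridColor N (edgeDist d s(u, v))) (gridColor N (edgeDist d s(v, w)))
      (gridColor N (edgeDist d s(u, w))) := by
  refine ⟨gridColor_le_add (edgeDist_mem_Icc hd u w).1 (edgeDist_triangle hd u v w),
    gridColor_le_add (edgeDist_mem_Icc hd u v).1 ?_,
    gridColor_le_add (edgeDist_mem_Icc hd v w).1 ?_⟩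
  · rw [add_comm, Sym2.eq_swap (a := v)]
    exact edgeDist_triangle hd u w v
  · rw [Sym2.eq_swap (a := u) (b := v)]
    exact edgeDist_triangle hd v u w

end Edges

section Volume

/-- The uniform probability measure on the cube `[0, 1] ^ ι`, as a measure on `ι → ℝ`. -/
noncomputable def cubeMeasure (ι : Type*) [Fintype ι] : Measure (ι → ℝ) :=
  Measure.pi fun _ ↦ volume.restrict (Set.Icc 0 1)

instance isProbabilityMeasure_restrict_Icc :
    IsProbabilityMeasure (volume.restrict (Set.Icc (0 : ℝ) 1)) :=
  ⟨by simp⟩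

instance (ι : Type*) [Fintype ι] : IsProbabilityMeasure (cubeMeasure ι) := by
  unfold cubeMeasure
  infer_instance

theorem cubeMeasure_apply_of_subset {ι : Type*} [Fintype ι] {s : Set (ι → ℝ)}
    (hs : s ⊆ Set.univ.pi fun _ ↦ Set.Icc 0 1) : cubeMeasure ι s = volume s := by
  rw [cubeMeasure, ← Measure.restrict_pi_pi, Measure.restrict_eq_self _ hs, volume_pi]

theorem cubeMeasure_metricPolytope (n : ℕ) :
    cubeMeasure (CompleteEdge n) (metricPolytope n) = volume (metricPolytope n) :=
  cubeMeasure_apply_of_subset fun _ hd e _ ↦ hd.1 e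

/-- The points of `ι → ℝ` with all but at most `m` coordinates in the grid cells allowed by the
palettes `A`. -/
def nearPalettes {ι : Type*} [Fintype ι] {N : ℕ} (A : ι → Finset (Fin (N + 1))) (m : ℝ) :
    Set (ι → ℝ) :=
  {d | (#{i | gridColor N (d i) ∉ A i} : ℝ) ≤ m}

theorem cubeMeasure_nearPalettes_le {ι : Type*} [Fintype ι] {N : ℕ} (A : ι → Finset (Fin (N + 1)))
    {L : ℝ} (hL : 0 ≤ L) (m : ℝ) :
    (cubeMeasure ι).real (nearPalettes A m) ≤ (1 / 2) ^ Fintype.card ι *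
      Real.exp (L * m + 2 * ∑ i, (Real.exp (-L) + #(A i) / (N + 1)) - Fintype.card ι) := by
  classical
  have hchernoff := measureReal_pi_card_notMem_le (fun _ : ι ↦ volume.restrict (Set.Icc (0 : ℝ) 1))
    (fun i ↦ measurableSet_gridColor_mem (A i)) hL m
  have hhalf := prod_le_half_pow_mul_exp (ι := ι) (x := fun i ↦ Real.exp (-L) + #(A i) / (N + 1))
    fun i ↦ by positivity
  calc (cubeMeasure ι).real (nearPalettes A m)
      ≤ Real.exp (L * m) * ∏ i, (Real.exp (-L) + (volume.restrict (Set.Icc (0 : ℝ) 1)).real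
          {x | gridColor N x ∈ A i}) := by
        simpa [cubeMeasure, nearPalettes] using hchernoff
    _ ≤ Real.exp (L * m) * ((1 / 2) ^ Fintype.card ι *
          Real.exp (2 * ∑ i, (Real.exp (-L) + #(A i) / (N + 1)) - Fintype.card ι)) := by
        gcongr
        refine le_trans ?_ hhalf
        gcongr
        exact measureReal_gridColor_mem_le _
    _ = _ := by
        rw [add_sub_assoc, Real.exp_add]
        ring

theorem two_mul_sum_completeEdge_le {n : ℕ} {F : Sym2 (Fin n) → ℝ} (hF : 0 ≤ F) {c : ℝ}
    (hc : 𝔼 u, 𝔼 v, F s(u, v) ≤ c) : 2 * ∑ e : CompleteEdge n, F e ≤ c * (n : ℝ) ^ 2 :=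
  calc 2 * ∑ e : CompleteEdge n, F e ≤ ∑ u, ∑ v, F s(u, v) := two_mul_sum_edgeSet_le _ hF
    _ = (𝔼 u, 𝔼 v, F s(u, v)) * (n : ℝ) ^ 2 := by
        simp only [← Fintype.card_mul_expect, ← mul_expect, Fintype.card_fin]
        ring
    _ ≤ c * (n : ℝ) ^ 2 := by gcongr

theorem exists_palettes_of_mem_metricPolytope (N : ℕ) {δ : ℝ} (hδ : 0 < δ) :
    ∃ M : ℕ, ∀ (n : ℕ) [NeZero n], ∀ d ∈ metricPolytope n,
      ∃ (π : Fin n → Fin M) (P : Sym2 (Fin M) → Finset (Fin (N + 1))),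
        2 * ∑ e : CompleteEdge n, (#(P (e.1.map π)) / (N + 1) : ℝ) ≤
          (1 / 2 + 1 / (N + 1) + δ) * (n : ℝ) ^ 2 ∧
        d ∈ nearPalettes (fun e : CompleteEdge n ↦ P (e.1.map π)) (δ * (n : ℝ) ^ 2 / 2) := by
  obtain ⟨M, hM⟩ := exists_small_palettes N hδ
  refine ⟨M, fun n _ d hd ↦ ?_⟩
  obtain ⟨π, P, hcover, hsize⟩ := hM (fun z ↦ gridColor N (edgeDist d z))
    (isRoundedTriangle_gridColor_edgeDist N hd)
  refine ⟨π, P, two_mul_sum_completeEdge_le (F := fun z ↦ (#(P (z.map π)) / (N + 1) : ℝ))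
    (fun z ↦ by positivity) hsize, ?_⟩
  have houtside := two_mul_sum_completeEdge_le
    (F := fun z ↦ if gridColor N (edgeDist d z) ∈ P (z.map π) then 0 else 1)
    (fun z ↦ by positivity) hcover
  have hcount : ∑ e : CompleteEdge n,
      (if gridColor N (edgeDist d e) ∈ P (e.1.map π) then 0 else 1 : ℝ) =
        #{e : CompleteEdge n | gridColor N (d e) ∉ P (e.1.map π)} := by
    rw [card_filter, Nat.cast_sum]
    refine sum_congr rfl fun e _ ↦ ?_
    rw [edgeDist_coe]
    split_ifs <;> simp_all
  rw [hcount] at houtside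
  rw [nearPalettes, Set.mem_ofPred_eq, le_div_iff₀' two_pos]
  exact houtside

theorem cubeMeasure_nearPalettes_completeEdge_le {n N : ℕ}
    {A : CompleteEdge n → Finset (Fin (N + 1))} {L δ : ℝ} (hL : 0 ≤ L)
    (hA : 2 * ∑ e, (#(A e) / (N + 1) : ℝ) ≤ (1 / 2 + 1 / (N + 1) + δ) * (n : ℝ) ^ 2) :
    (cubeMeasure _).real (nearPalettes A (δ * (n : ℝ) ^ 2 / 2)) ≤ (1 / 2) ^ n.choose 2 *
      Real.exp ((L * δ / 2 + Real.exp (-L) + 1 / (N + 1) + δ) * (n : ℝ) ^ 2 + n / 2) := by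
  have hchoose : (n.choose 2 : ℝ) = (n : ℝ) ^ 2 / 2 - n / 2 := by
    rw [Nat.cast_choose_two]
    ring
  have hexp : 0 ≤ n * Real.exp (-L) := by positivity
  refine (cubeMeasure_nearPalettes_le A hL _).trans ?_
  rw [card_completeEdge, sum_add_distrib, sum_const, card_univ, card_completeEdge, nsmul_eq_mul,
    hchoose]
  gcongr
  linarith

theorem exists_volume_metricPolytope_le (N : ℕ) {δ L : ℝ} (hδ : 0 < δ) (hL : 0 ≤ L) :
    ∃ M D : ℕ, ∀ (n : ℕ) [NeZero n], volume.real (metricPolytope n) ≤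
      (M ^ n * D : ℕ) * ((1 / 2) ^ n.choose 2 *
        Real.exp ((L * δ / 2 + Real.exp (-L) + 1 / (N + 1) + δ) * (n : ℝ) ^ 2 + n / 2)) := by
  classical
  obtain ⟨M, hM⟩ := exists_palettes_of_mem_metricPolytope N hδ
  refine ⟨M, Fintype.card (Sym2 (Fin M) → Finset (Fin (N + 1))), fun n _ ↦ ?_⟩
  let palette (t : (Fin n → Fin M) × (Sym2 (Fin M) → Finset (Fin (N + 1)))) (e : CompleteEdge n) :=
    t.2 (e.1.map t.1)
  let J : Finset ((Fin n → Fin M) × (Sym2 (Fin M) → Finset (Fin (N + 1)))) :=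
    {t | 2 * ∑ e, (#(palette t e) / (N + 1) : ℝ) ≤ (1 / 2 + 1 / (N + 1) + δ) * (n : ℝ) ^ 2}
  have hcover : metricPolytope n ⊆ ⋃ t ∈ J, nearPalettes (palette t) (δ * (n : ℝ) ^ 2 / 2) := by
    intro d hd
    obtain ⟨π, P, hsize, hmem⟩ := hM n d hd
    exact Set.mem_biUnion (x := (π, P)) (by simpa [J, palette] using hsize) hmem
  rw [measureReal_def, ← cubeMeasure_metricPolytope, ← measureReal_def]
  calc _ ≤ ∑ t ∈ J, (cubeMeasure _).real (nearPalettes (palette t) (δ * (n : ℝ) ^ 2 / 2)) :=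
        (measureReal_mono hcover (measure_ne_top _ _)).trans (measureReal_biUnion_finset_le _ _)
    _ ≤ #J * _ := by
        rw [← nsmul_eq_mul]
        exact sum_le_card_nsmul _ _ _ fun t ht ↦
          cubeMeasure_nearPalettes_completeEdge_le hL (mem_filter.1 ht).2
    _ ≤ _ := by
        gcongr
        simpa [Fintype.card_prod] using card_le_univ J

theorem eventually_pow_mul_le_exp_mul_sq {A B δ : ℝ} (hA : 0 ≤ A) (hB : 0 ≤ B) (hδ : 0 < δ) :
    ∀ᶠ n : ℕ in Filter.atTop, A ^ n * B ≤ Real.exp (δ * (n : ℝ) ^ 2) := by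
  filter_upwards [Filter.eventually_ge_atTop 1, Filter.eventually_ge_atTop ⌈(A + B) / δ⌉₊]
    with n hn hAB
  have hn : (1 : ℝ) ≤ n := by exact_mod_cast hn
  rw [Nat.ceil_le, div_le_iff₀' hδ] at hAB
  calc A ^ n * B ≤ Real.exp A ^ n * Real.exp B := by
        gcongr
        · exact (lt_add_one A).le.trans (Real.add_one_le_exp A)
        · exact (lt_add_one B).le.trans (Real.add_one_le_exp B)
    _ = Real.exp (n * A + B) := by rw [← Real.exp_nat_mul, Real.exp_add]
    _ ≤ Real.exp (δ * (n : ℝ) ^ 2) := by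
        gcongr
        nlinarith

theorem eventually_volume_metricPolytope_le {δ : ℝ} (hδ : 0 < δ) :
    ∀ᶠ n : ℕ in Filter.atTop, volume.real (metricPolytope n) ≤
      (1 / 2) ^ n.choose 2 * Real.exp (δ * (n : ℝ) ^ 2) := by
  obtain ⟨L, hL, hLδ⟩ : ∃ L : ℝ, 0 ≤ L ∧ Real.exp (-L) ≤ δ / 8 := by
    refine ⟨max 0 (-Real.log (δ / 8)), le_max_left _ _, ?_⟩
    rw [← Real.le_log_iff_exp_le (by positivity)]
    linarith [le_max_right 0 (-Real.log (δ / 8))]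
  obtain ⟨N, hN⟩ := exists_nat_one_div_lt (show 0 < δ / 8 by positivity)
  obtain ⟨ε, hε, hεδ⟩ : ∃ ε : ℝ, 0 < ε ∧ L * ε / 2 + ε = δ / 8 :=
    ⟨δ / (4 * (L + 2)), by positivity, by field_simp; ring⟩
  obtain ⟨M, D, hvolume⟩ := exists_volume_metricPolytope_le N hε hL
  filter_upwards [Filter.eventually_ge_atTop 1, eventually_pow_mul_le_exp_mul_sq
    (A := M * Real.exp (1 / 2)) (B := D) (by positivity) (by positivity) (half_pos hδ)]
    with n hn hcard
  have : NeZero n := ⟨by omega⟩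
  calc volume.real (metricPolytope n)
      ≤ (M ^ n * D : ℕ) * ((1 / 2) ^ n.choose 2 * Real.exp ((L * ε / 2 + Real.exp (-L) +
          1 / (N + 1) + ε) * (n : ℝ) ^ 2 + n / 2)) := hvolume n
    _ ≤ (M ^ n * D : ℕ) * ((1 / 2) ^ n.choose 2 * Real.exp (δ / 2 * (n : ℝ) ^ 2 + n / 2)) := by
        gcongr
        linarith
    _ = (1 / 2) ^ n.choose 2 * (((M * Real.exp (1 / 2)) ^ n * D) *
          Real.exp (δ / 2 * (n : ℝ) ^ 2)) := by
        rw [Real.exp_add, mul_pow, ← Real.exp_nat_mul]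
        push_cast
        ring_nf
    _ ≤ (1 / 2) ^ n.choose 2 * (Real.exp (δ / 2 * (n : ℝ) ^ 2) *
          Real.exp (δ / 2 * (n : ℝ) ^ 2)) := by gcongr
    _ = (1 / 2) ^ n.choose 2 * Real.exp (δ * (n : ℝ) ^ 2) := by
        rw [← Real.exp_add]
        ring_nf

theorem Icc_half_one_pi_subset_metricPolytope (n : ℕ) :
    (Set.univ.pi fun _ ↦ Set.Icc (1 / 2) 1) ⊆ metricPolytope n := by
  intro d hd
  have hhalf (e) : 1 / 2 ≤ d e ∧ d e ≤ 1 := hd e trivial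
  refine ⟨fun e ↦ ⟨by linarith [hhalf e], (hhalf e).2⟩, fun i j k hij hjk hik ↦ ?_⟩
  linarith [hhalf (completeEdge i k hik), hhalf (completeEdge i j hij),
    hhalf (completeEdge j k hjk)]

theorem volume_metricPolytope_ne_top (n : ℕ) : volume (metricPolytope n) ≠ ⊤ :=
  cubeMeasure_metricPolytope n ▸ measure_ne_top _ _

theorem half_pow_le_volume_metricPolytope (n : ℕ) :
    (1 / 2) ^ n.choose 2 ≤ volume.real (metricPolytope n) := by
  refine le_trans (le_of_eq ?_) (measureReal_mono (Icc_half_one_pi_subset_metricPolytope n)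
    (volume_metricPolytope_ne_top n))
  rw [measureReal_def, volume_pi_pi, ENNReal.toReal_prod]
  simp only [Real.volume_Icc, prod_const, card_univ, card_completeEdge]
  norm_num

theorem isLittleO_logb_sub {ι : Type*} {l : Filter ι} {b : ℝ} (hb₀ : 0 < b) (hb₁ : b < 1)
    {w g : ι → ℝ} {c : ι → ℕ} (hlower : ∀ n, b ^ c n ≤ w n)
    (hupper : ∀ δ > 0, ∀ᶠ n in l, w n ≤ b ^ c n * Real.exp (δ * g n)) :
    (fun n ↦ Real.logb b (w n) - c n) =o[l] g := by
  have hlog : 0 < -Real.log b := neg_pos.2 (Real.log_neg hb₀ hb₁)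
  refine IsLittleO.of_bound fun δ hδ ↦ ?_
  filter_upwards [hupper (δ * -Real.log b) (by positivity)] with n hn
  have hw : 0 < w n := (pow_pos hb₀ _).trans_le (hlower n)
  have hlog_lower := Real.log_le_log (pow_pos hb₀ _) (hlower n)
  have hlog_upper := Real.log_le_log hw hn
  rw [Real.log_mul (pow_pos hb₀ _).ne' (Real.exp_pos _).ne', Real.log_exp, Real.log_pow]
    at hlog_upper
  rw [Real.log_pow] at hlog_lower
  have hquotient :
      Real.logb b (w n) - c n = -((Real.log (w n) - c n * Real.log b) / -Real.log b) := by
    rw [Real.logb, div_neg, neg_neg, sub_div, mul_div_cancel_right₀ _ (Real.log_neg hb₀ hb₁).ne]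
  rw [hquotient, norm_neg, Real.norm_eq_abs, abs_of_nonneg (div_nonneg (by linarith) hlog.le),
    div_le_iff₀ hlog, Real.norm_eq_abs]
  nlinarith [le_abs_self (g n), mul_pos hδ hlog]

end Volume

end

theorem mainTheorem8 :
    ∃ r : ℕ → ℝ,
      r =o[Filter.atTop] (fun n : ℕ => (n : ℝ) ^ 2) ∧
      ∀ n : ℕ, volume (metricPolytope n) =
        ENNReal.ofReal ((1 / 2 : ℝ) ^ ((n.choose 2 : ℝ) + r n)) := by
  refine ⟨fun n ↦ Real.logb (1 / 2) (volume.real (metricPolytope n)) - n.choose 2, ?_, fun n ↦ ?_⟩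
  · exact isLittleO_logb_sub (by norm_num) (by norm_num) half_pow_le_volume_metricPolytope
      fun δ hδ ↦ eventually_volume_metricPolytope_le hδ
  · have hpos : 0 < volume.real (metricPolytope n) :=
      lt_of_lt_of_le (by positivity) (half_pow_le_volume_metricPolytope n)
    rw [add_sub_cancel, Real.rpow_logb (by norm_num) (by norm_num) hpos,
      ofReal_measureReal (volume_metricPolytope_ne_top n)]
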